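/- **Proposition (secrecy capacity at the MBCR point for any $n\ge d+t$).** Let $1\le k\le d$, $t\ge 1$, $n\ge d+t$, $0\le \ell_1\le k$, and let $\mathbb F_q$ be a finite field. *Setting.* A storage system with $n$ nodes of $\alpha$ symbols each over $\mathbb F_q$ stores a file ${\bf f}\in\mathbb F_q^{\mathcal M}$. In a repair stage any $t$ nodes fail simultaneously; each newcomer downloads $\beta$ symbols from each of $d$ arbitrary live nodes, then receives $\beta'$ symbols (functions of the sender's downloads) from each of the other $t-1$ newcomers, and stores $\alpha$ symbols computed from what it received. After every sequence of repairs, ${\bf f}$ must be recoverable from the contents of any $k$ nodes. The repair is *exact* if it always restores the original contents. An *MBCR code* is such a code at the normalized MBCR point $\mathcal M=k(2d-k+t)$, $\alpha=2d+t-1$, $\beta=2$, $\beta'=1$. It *achieves the secure file size* $\mathcal M^s$ against an $(\ell_1,0)$ eavesdropper if a uniformly distributed secure file ${\bf f}^s\in\mathbb F_q^{\mathcal M^s}$ can be encoded, possibly using randomness, into ${\bf f}$ so that ${\bf f}^s$ is a function of ${\bf f}$, and $I({\bf f}^s;{\bf e})=0$ whenever ${\bf e}$ consists of the stored contents of $\ell_1$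 storage nodes (original or newcomer nodes, possibly present at different times of one sequence of repairs). The *secrecy capacity* is the largest achievable $\mathcal M^s$. *Claim.* Put $\mathcal M^s_*=k(2d-k+t)-\ell_1(2d-\ell_1+t)$. 1. Over every $\mathbb F_q$, every achievable secure file size is at most $\mathcal M^s_*$. 2. If $q>n$, then the secrecy capacity is $\mathcal M^s_*$, both among all MBCR codes and among MBCR codes with exact repair. 3. The following scheme attains it, for any distinct $x_1,\dots,x_n\in\mathbb F_q$ and any distinct $y_1,\dots,y_n\in\mathbb F_q$. For $m\le d$ let $S_m$ be the set of pairs $(i,j)$ with $0\le i<d$, $0\le j<d+t$ and ($i<m$ or $j<m$); then $|S_k|=k(2d-k+t)$, $|S_{\ell_1}|=\ell_1(2d-\ell_1+t)$ and $|S_k\setminus S_{\ell_1}|=\mathcal M^s_*$. Let $F(X,Y)=\sum_{(i,j)\in S_k}f_{ij}X^iY^j$, where the coefficients with $(i,j)\in S_{\ell_1}$ are i.i.d. uniform random symbols ${\bf r}$ and the others are the data symbols ${\bf u}$. Node $i$ stores $F(x_i,y_{i\oplus s})$ for $0\le s\le d+t-1$ and $F(x_{i\oplus s},y_i)$ for $1\le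 s\le d-1$, with $\oplus$ addition modulo $n$. These contents are those of an MBCR code with exact repair, which with this choice of coefficients achieves the secure file size $\mathcal M^s_*$ against an $(\ell_1,0)$ eavesdropper. Moreover ${\bf r}$ can be decoded from ${\bf u}$ and the contents of any $\ell_1$ nodes, and the polynomial left over when the data monomials are removed from $F$ is $\sum_{(i,j)\in S_{\ell_1}}r_{ij}X^iY^j$, which has the form of $F$ with $k$ replaced by $\ell_1$. -/

import Mathlib

open scoped Polynomial

noncomputable section

/-! ### Shannon information of finitely-valued random variables -/

/-- Shannon entropy `H(X)` (in nats) of a random variable `X` with values in a finite set. -/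
def shannonEntropy {Ω A : Type*} [Fintype A] (p : PMF Ω) (X : Ω → A) : ℝ :=
  ∑ a, Real.negMulLog (p.map X a).toReal

/-- Mutual information `I(X;Y) = H(X) + H(Y) - H(X,Y)`. -/
def mutualInfo {Ω A B : Type*} [Fintype A] [Fintype B] (p : PMF Ω) (X : Ω → A) (Y : Ω → B) : ℝ :=
  shannonEntropy p X + shannonEntropy p Y - shannonEntropy p (fun ω => (X ω, Y ω))

/-! ### Distributed storage systems with cooperative repair -/

/-- One repair stage: `t` of the `n` nodes fail simultaneously, and the newcomer that replaces a
failed node contacts `d` live nodes (its own choice). -/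
structure RepairEvent (n d t : ℕ) where
  failed : Finset (Fin n)
  card_failed : failed.card = t
  helpers : failed → Finset (Fin n)
  card_helpers : ∀ i, (helpers i).card = d
  helpers_live : ∀ i, Disjoint (helpers i) failed

/-- The other newcomers of the repair group of `i`. -/
abbrev RepairEvent.Peer {n d t : ℕ} (e : RepairEvent n d t) (i : e.failed) : Type :=
  {i' : e.failed // i' ≠ i}

/-- A coding scheme for a storage system with `n` nodes of `α` symbols each, for files
`ι → F` (so of size `|ι|` over `F`). Histories are lists of repair stages, the latest first;
all repair rules may depend on the past history.
* `encode f i` is the initial content of node `i`;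
* `send h e i j s` are the `β` symbols which the newcomer `i` downloads from the live node `j`,
  whose current content is `s`;
* `coop h e i' i m` are the `β'` symbols which the newcomer `i'`, having downloaded `m` from its
  live helpers, passes on to the newcomer `i` of the same group;
* `rebuild h e i m m'` is what the newcomer `i` stores, having received `m` from the live helpers
  and `m'` from the other newcomers. -/
structure CoopCode (F : Type*) (ι : Type*) (n d t α β β' : ℕ) where
  encode : (ι → F) → Fin n → Fin α → F
  send : List (RepairEvent n d t) → (e : RepairEvent n d t) → (i : e.failed) → e.helpers i →
    (Fin α → F) → Fin β → F
  coop : List (RepairEvent n d t) → (e : RepairEvent n d t) → (i' i : e.failed) →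
    (e.helpers i' → Fin β → F) → Fin β' → F
  rebuild : List (RepairEvent n d t) → (e : RepairEvent n d t) → (i : e.failed) →
    (e.helpers i → Fin β → F) → (e.Peer i → Fin β' → F) → Fin α → F

namespace CoopCode

variable {F ι : Type*} {n d t α β β' : ℕ}

/-- The content of every node after the given history of repairs, if the file is `f`. -/
def contents (C : CoopCode F ι n d t α β β') :
    List (RepairEvent n d t) → (ι → F) → Fin n → Fin α → F
  | [], f => C.encode f
  | e :: h, f => fun i =>
      if hi : i ∈ e.failed then
        let download : (i : e.failed) → e.helpers i → Fin β → F :=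
          fun i j => C.send h e i j (C.contents h f j)
        C.rebuild h e ⟨i, hi⟩ (download ⟨i, hi⟩)
          (fun i' => C.coop h e i'.1 ⟨i, hi⟩ (download i'.1))
      else C.contents h f i

/-- The "any `k` out of `n`" property: at any time, the file can be recovered from the contents
of any `k` nodes. -/
def RecoversFile (C : CoopCode F ι n d t α β β') (k : ℕ) : Prop :=
  ∀ (h : List (RepairEvent n d t)) (K : Finset (Fin n)), K.card = k →
    ∃ D : (K → Fin α → F) → (ι → F), ∀ f, D (fun i => C.contents h f i) = f

/-- Exact repair: every repair restores exactly the original contents. -/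
def IsExactRepair (C : CoopCode F ι n d t α β β') : Prop :=
  ∀ h f, C.contents h f = C.encode f

end CoopCode

/-- The joint law of the secure file `u`, uniform on `κ → F`, and of the stored file `f`, which a
(randomized) precoder draws from the law `enc u`. -/
def precodedLaw {F ι κ : Type*} [Fintype F] [Nonempty F] [Fintype κ] [DecidableEq κ]
    (enc : (κ → F) → PMF (ι → F)) : PMF ((κ → F) × (ι → F)) :=
  (PMF.uniformOfFintype (κ → F)).bind fun u => (enc u).map fun f => (u, f)

/-- The system `C`, with the precoder `enc`, achieves the secure file size `|κ|` against an
`(ℓ,0)` eavesdropper: the secure file is a function of the stored file, and the contents of any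
`ℓ` storage nodes, where nodes that are present at different times of a history may be combined,
carry no information on the secure file. (`h.drop m` runs through the earlier stages of the
history `h`.) -/
def CoopCode.IsSecure {F ι κ : Type*} {n d t α β β' : ℕ} [Fintype F] [Nonempty F]
    [Fintype κ] [DecidableEq κ] (C : CoopCode F ι n d t α β β') (ℓ : ℕ)
    (enc : (κ → F) → PMF (ι → F)) : Prop :=
  (∃ dec : (ι → F) → (κ → F), ∀ u, ∀ f ∈ (enc u).support, dec f = u) ∧
  ∀ (h : List (RepairEvent n d t)) (E : Finset (Fin (h.length + 1) × Fin n)), E.card = ℓ →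
    mutualInfo (precodedLaw enc) Prod.fst
      (fun ω (v : E) => C.contents (h.drop v.1.1) ω.2 v.1.2) = 0

/-- A storage code at the (normalized) minimum bandwidth cooperative regenerating point:
`α = 2d+t-1`, `β = 2`, `β' = 1`; its file size is `k(2d-k+t)` if `|ι| = k(2d-k+t)`. -/
abbrev MBCRCode (F : Type*) (ι : Type*) (n d t : ℕ) : Type _ :=
  CoopCode F ι n d t (2 * d + t - 1) 2 1

/-- The secure file sizes that MBCR codes with file size `k(2d-k+t)` over `F` achieve against an
`(ℓ,0)` eavesdropper; the secrecy capacity is the greatest element. -/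
def mbcrSecureSizes (F : Type*) [Fintype F] [Nonempty F] (n k d t ℓ : ℕ) : Set ℕ :=
  {Ms | ∃ (C : MBCRCode F (Fin (k * (2 * d - k + t))) n d t)
      (enc : (Fin Ms → F) → PMF (Fin (k * (2 * d - k + t)) → F)),
      C.RecoversFile k ∧ C.IsSecure ℓ enc}

/-- The same for codes with exact repair. -/
def mbcrExactSecureSizes (F : Type*) [Fintype F] [Nonempty F] (n k d t ℓ : ℕ) : Set ℕ :=
  {Ms | ∃ (C : MBCRCode F (Fin (k * (2 * d - k + t))) n d t)
      (enc : (Fin Ms → F) → PMF (Fin (k * (2 * d - k + t)) → F)),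
      C.RecoversFile k ∧ C.IsExactRepair ∧ C.IsSecure ℓ enc}

/-! ### The bivariate polynomial code -/

/-- The exponents `(i, j)` of the monomials `X ^ i * Y ^ j` of the code polynomial:
`i < d`, `j < d + t`, and `i < k` or `j < k`. -/
abbrev CodeMonomial (d t k : ℕ) : Type :=
  {p : Fin d × Fin (d + t) // p.1.val < k ∨ p.2.val < k}

/-- The exponents of `CodeMonomial d t k` that are not in `CodeMonomial d t ℓ`; their
coefficients carry the data. -/
abbrev DataMonomial (d t k ℓ : ℕ) : Type :=
  {p : Fin d × Fin (d + t) // (p.1.val < k ∨ p.2.val < k) ∧ ¬ (p.1.val < ℓ ∨ p.2.val < ℓ)}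

/-- The polynomial `F(X,Y)` with the given coefficients; `X` is the inner variable of
`F[X][Y]`. -/
def codePoly {F : Type*} [Field F] {d t k : ℕ} (f : CodeMonomial d t k → F) : F[X][X] :=
  ∑ p, Polynomial.monomial p.1.2.val (Polynomial.monomial p.1.1.val (f p))

/-- `i ⊕ s`, addition modulo `n`. -/
def cyclicAdd {n : ℕ} (i : Fin n) (s : ℕ) : Fin n :=
  ⟨(i.val + s) % n, Nat.mod_lt _ i.pos⟩

/-- Node `i` stores `F(x_i, y_{i⊕s})` for `0 ≤ s ≤ d+t-1`, and `F(x_{i⊕s}, y_i)` for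
`1 ≤ s ≤ d-1`. -/
def polyEncode {F : Type*} [Field F] {n d t k : ℕ} (x y : Fin n → F)
    (f : CodeMonomial d t k → F) (i : Fin n) (s : Fin (2 * d + t - 1)) : F :=
  if s.val < d + t then (codePoly f).evalEval (x i) (y (cyclicAdd i s))
  else (codePoly f).evalEval (x (cyclicAdd i (s - (d + t) + 1))) (y i)

/-- The coefficients of the code polynomial: the random symbols `r` at the monomials with
`i < ℓ` or `j < ℓ`, and the data symbols `u` at the others. -/
def fillCoeffs {F : Type*} {d t k ℓ : ℕ} (u : DataMonomial d t k ℓ → F)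
    (r : CodeMonomial d t ℓ → F) : CodeMonomial d t k → F := fun p =>
  if hp : p.1.1.val < ℓ ∨ p.1.2.val < ℓ then r ⟨p.1, hp⟩ else u ⟨p.1, p.2, hp⟩

/-- The precoder: the random symbols are independent and uniform. -/
def randomFill {F : Type*} [Fintype F] [Nonempty F] {d t k ℓ : ℕ}
    (u : DataMonomial d t k ℓ → F) : PMF (CodeMonomial d t k → F) :=
  (PMF.uniformOfFintype (CodeMonomial d t ℓ → F)).map (fillCoeffs u)

end

/-!
The upper bound is a cut-set argument. Repair the nodes `ℓ, …, k - 1` one after the other, each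
with the help of all its predecessors. When node `m` is repaired, `m` of its helpers are
predecessors, so that its new contents are a function of theirs and of `2 (d - m) + (t - 1)`
further symbols (`CoopCode.exists_history_of_cut`). Hence the contents of the first `ℓ` nodes,
together with `∑ (2 (d - m) + (t - 1))` symbols, which is the claimed bound, determine the contents
of `k` nodes and so the file. Let the eavesdropper observe the first `ℓ` nodes. Zero mutual
information means that the observation and the secure file are independent
(`mem_support_prod_of_mutualInfo_eq_zero`), so one and the same observation is compatible with all
secure files, and the further symbols have to tell them apart (`card_le_of_mutualInfo_eq_zero`).

For the polynomial code, the contents of node `i` amount to the restrictions of the code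
polynomial to the lines `X = x i` and `Y = y i`, as its degrees in `X` and `Y` are less than `d`
and `d + t` (`polyEncode_eq_iff`); a newcomer recovers these two univariate polynomials from what
it receives (`polyCode_isExactRepair`). A polynomial with the monomials `i < k` or `j < k` that
vanishes on `k` vertical and `k` horizontal lines is zero (`array_eq_zero_of_lines`): this shows
that `k` nodes determine the file, and, with `ℓ` in place of `k`, that `ℓ` nodes and the data
determine the random symbols. Conversely, every polynomial agrees on `ℓ` vertical and `ℓ`
horizontal lines with one that has only the monomials of the random symbols
(`exists_array_eq_on_lines`). So a change of the data acts on the contents of `ℓ` nodes as a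
translation of the random symbols, which preserves their uniform law, and the law of these
contents does not depend on the data (`polyCode_isPerfectlySecret`). Under exact repair, nodes that
are observed at different times count as nodes observed at one time.
-/

/-! ### Mutual information and independence -/

theorem PMF.sum_toReal_eq_one {A : Type*} [Fintype A] (p : PMF A) : ∑ a, (p a).toReal = 1 := by
  rw [← ENNReal.toReal_sum (fun a _ => p.apply_ne_top a), ← tsum_fintype (L := .unconditional _),
    p.tsum_coe, ENNReal.toReal_one]

theorem PMF.toReal_map_fst {A B : Type*} [Fintype A] [Fintype B] (p : PMF (A × B)) (a : A) :
    (p.map Prod.fst a).toReal = ∑ b, (p (a, b)).toReal := by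
  classical
  rw [← ENNReal.toReal_sum (fun b _ => p.apply_ne_top _), PMF.map_apply,
    tsum_fintype, Fintype.sum_prod_type]
  congr 1
  rw [Finset.sum_eq_single a] <;> simp +contextual [eq_comm]

theorem PMF.toReal_map_snd {A B : Type*} [Fintype A] [Fintype B] (p : PMF (A × B)) (b : B) :
    (p.map Prod.snd b).toReal = ∑ a, (p (a, b)).toReal := by
  classical
  rw [← ENNReal.toReal_sum (fun b _ => p.apply_ne_top _), PMF.map_apply,
    tsum_fintype, Fintype.sum_prod_type_right]
  congr 1
  rw [Finset.sum_eq_single b] <;> simp +contextual [eq_comm]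

/-- If the mutual information vanishes, then the support of the joint law is the product of the
supports of the marginals. By `log x ≤ x - 1`, the mutual information is at least
`1 - ∑ P(X = a) P(Y = b)`, the sum being over the support of the joint law; hence the product law
puts no mass outside that support. -/
theorem mem_support_prod_of_mutualInfo_eq_zero {Ω A B : Type*} [Fintype A] [Fintype B]
    {p : PMF Ω} {X : Ω → A} {Y : Ω → B} (h : mutualInfo p X Y = 0) {a : A} {b : B}
    (ha : a ∈ (p.map X).support) (hb : b ∈ (p.map Y).support) :
    (a, b) ∈ (p.map fun ω => (X ω, Y ω)).support := by
  classical
  set μ := p.map fun ω => (X ω, Y ω) with hμ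
  have hX : p.map X = μ.map Prod.fst := by rw [hμ, PMF.map_comp]; rfl
  have hY : p.map Y = μ.map Prod.snd := by rw [hμ, PMF.map_comp]; rfl
  let P : A × B → ℝ := fun z => (μ z).toReal
  let u : A → ℝ := fun a => (p.map X a).toReal
  let v : B → ℝ := fun b => (p.map Y b).toReal
  have hP0 : ∀ z, 0 ≤ P z := fun z => ENNReal.toReal_nonneg
  have hu0 : ∀ a, 0 ≤ u a := fun z => ENNReal.toReal_nonneg
  have hv0 : ∀ b, 0 ≤ v b := fun z => ENNReal.toReal_nonneg
  have hu : ∀ a, u a = ∑ b, P (a, b) := fun a => by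
    simp only [u, hX]; exact PMF.toReal_map_fst μ a
  have hv : ∀ b, v b = ∑ a, P (a, b) := fun b => by
    simp only [v, hY]; exact PMF.toReal_map_snd μ b
  have hP1 : ∑ z, P z = 1 := PMF.sum_toReal_eq_one μ
  have huv1 : ∑ z : A × B, u z.1 * v z.2 = 1 := by
    rw [Fintype.sum_prod_type, ← Finset.sum_mul_sum, PMF.sum_toReal_eq_one,
      PMF.sum_toReal_eq_one, one_mul]
  have hPu : ∀ z, 0 < P z → 0 < u z.1 := fun z hz => by
    rw [hu]; exact hz.trans_le
      (Finset.single_le_sum (f := fun b => P (z.1, b)) (fun b _ => hP0 _) (Finset.mem_univ z.2))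
  have hPv : ∀ z, 0 < P z → 0 < v z.2 := fun z hz => by
    rw [hv]; exact hz.trans_le
      (Finset.single_le_sum (f := fun a => P (a, z.2)) (fun b _ => hP0 _) (Finset.mem_univ z.1))
  have hI : ∑ z, P z * (Real.log (P z) - Real.log (u z.1) - Real.log (v z.2)) = 0 := by
    rw [← h]
    have e1 : shannonEntropy p X = -∑ z, P z * Real.log (u z.1) := by
      rw [Fintype.sum_prod_type, ← Finset.sum_neg_distrib]
      refine Finset.sum_congr rfl fun a _ => ?_
      dsimp only
      rw [← Finset.sum_mul, ← hu, Real.negMulLog, neg_mul]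
    have e2 : shannonEntropy p Y = -∑ z, P z * Real.log (v z.2) := by
      rw [Fintype.sum_prod_type_right, ← Finset.sum_neg_distrib]
      refine Finset.sum_congr rfl fun a _ => ?_
      dsimp only
      rw [← Finset.sum_mul, ← hv, Real.negMulLog, neg_mul]
    have e3 : shannonEntropy p (fun ω => (X ω, Y ω)) = -∑ z, P z * Real.log (P z) := by
      rw [← Finset.sum_neg_distrib]
      refine Finset.sum_congr rfl fun a _ => ?_
      rw [Real.negMulLog, neg_mul]
    rw [mutualInfo, e1, e2, e3]
    simp only [mul_sub, Finset.sum_sub_distrib]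
    ring
  have hterm : ∀ z, P z - (if P z = 0 then 0 else u z.1 * v z.2) ≤
      P z * (Real.log (P z) - Real.log (u z.1) - Real.log (v z.2)) := fun z => by
    rcases (hP0 z).eq_or_lt with hz | hz
    · simp [← hz]
    · have h1 := hPu z hz
      have h2 := hPv z hz
      rw [if_neg hz.ne']
      have := Real.log_le_sub_one_of_pos (x := u z.1 * v z.2 / P z) (by positivity)
      rw [Real.log_div (by positivity) hz.ne', Real.log_mul h1.ne' h2.ne'] at this
      have h3 := mul_le_mul_of_nonneg_left this hz.le
      have h4 : P z * (u z.1 * v z.2 / P z - 1) = u z.1 * v z.2 - P z := by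
        field_simp
      linarith
  have hle := Finset.sum_le_sum fun z (_ : z ∈ Finset.univ) => hterm z
  rw [hI, Finset.sum_sub_distrib, hP1, ← huv1, ← Finset.sum_sub_distrib] at hle
  have hnn : ∀ z ∈ Finset.univ, 0 ≤ u z.1 * v z.2 - (if P z = 0 then 0 else u z.1 * v z.2) :=
    fun z _ => by
      split_ifs
      · simpa using mul_nonneg (hu0 _) (hv0 _)
      · simp
  have h0 := (Finset.sum_eq_zero_iff_of_nonneg hnn).1 (le_antisymm hle (Finset.sum_nonneg hnn))
    (a, b) (Finset.mem_univ _)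
  rw [PMF.mem_support_iff] at ha hb ⊢
  intro hab
  rw [if_pos (by simp [P, hab]), sub_zero, mul_eq_zero] at h0
  rcases h0 with h0 | h0
  · exact ha (((ENNReal.toReal_eq_zero_iff _).1 h0).resolve_right (PMF.apply_ne_top _ _))
  · exact hb (((ENNReal.toReal_eq_zero_iff _).1 h0).resolve_right (PMF.apply_ne_top _ _))

theorem mutualInfo_eq_zero_of_forall_mul {Ω A B : Type*} [Fintype A] [Fintype B]
    {p : PMF Ω} {X : Ω → A} {Y : Ω → B}
    (h : ∀ a b, p.map (fun ω => (X ω, Y ω)) (a, b) = p.map X a * p.map Y b) :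
    mutualInfo p X Y = 0 := by
  have e : shannonEntropy p (fun ω => (X ω, Y ω)) = shannonEntropy p X + shannonEntropy p Y := by
    simp only [shannonEntropy, Fintype.sum_prod_type, h, ENNReal.toReal_mul, Real.negMulLog_mul,
      Finset.sum_add_distrib, ← Finset.sum_mul, ← Finset.mul_sum, PMF.sum_toReal_eq_one, one_mul]
  rw [mutualInfo, e, sub_self]

/-- If the conditional law of an observation of the stored file does not depend on the secure
file, then the observation carries no information on the secure file. -/
theorem mutualInfo_precodedLaw_eq_zero {F ι κ B : Type*} [Fintype F] [Nonempty F] [Fintype κ]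
    [DecidableEq κ] [Fintype B] {enc : (κ → F) → PMF (ι → F)} {Y : (ι → F) → B} {μ : PMF B}
    (h : ∀ u, (enc u).map Y = μ) :
    mutualInfo (precodedLaw enc) Prod.fst (fun ω => Y ω.2) = 0 := by
  classical
  have hX : (precodedLaw enc).map Prod.fst = PMF.uniformOfFintype (κ → F) := by
    simp only [precodedLaw, PMF.map_bind, PMF.map_comp]
    have : ∀ u : κ → F, PMF.map (Prod.fst ∘ fun f : ι → F => (u, f)) (enc u) = PMF.pure u :=
      fun u => PMF.map_const _ _
    simp only [this, PMF.bind_pure]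
  have hY : (precodedLaw enc).map (fun ω => Y ω.2) = μ := by
    simp only [precodedLaw, PMF.map_bind, PMF.map_comp]
    have : ∀ u : κ → F, PMF.map ((fun ω : (κ → F) × (ι → F) => Y ω.2) ∘ fun f => (u, f)) (enc u)
      = μ := h
    simp only [this, PMF.bind_const]
  have hXY : (precodedLaw enc).map (fun ω => (ω.1, Y ω.2)) =
      (PMF.uniformOfFintype (κ → F)).bind fun u => μ.map (Prod.mk u) := by
    simp only [precodedLaw, PMF.map_bind, PMF.map_comp]
    congr 1
    funext u
    rw [← h u, PMF.map_comp]
    rfl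
  refine mutualInfo_eq_zero_of_forall_mul fun a b => ?_
  rw [hX, hY, hXY, PMF.bind_apply, tsum_eq_single a, PMF.map_apply, tsum_eq_single b]
  · simp
  · intro b' hb'; simp [hb'.symm]
  · intro a' ha'
    simp [PMF.map_apply, ha'.symm]

/-! ### The upper bound on the secure file size -/

theorem CoopCode.contents_cons_of_mem {F ι : Type*} {n d t α β β' : ℕ}
    (C : CoopCode F ι n d t α β β') {e : RepairEvent n d t} {h : List (RepairEvent n d t)}
    {f : ι → F} (i : e.failed) :
    C.contents (e :: h) f i.1 = C.rebuild h e i (fun j => C.send h e i j (C.contents h f j))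
      (fun i' => C.coop h e i'.1 i fun j => C.send h e i'.1 j (C.contents h f j)) := by
  simp only [CoopCode.contents, dif_pos i.2]

theorem CoopCode.contents_cons_of_notMem {F ι : Type*} {n d t α β β' : ℕ}
    (C : CoopCode F ι n d t α β β') {e : RepairEvent n d t} {h : List (RepairEvent n d t)}
    {f : ι → F} {i : Fin n} (hi : i ∉ e.failed) :
    C.contents (e :: h) f i = C.contents h f i := by
  simp only [CoopCode.contents, dif_neg hi]

/-- The repair stage in which the nodes `m, …, m + t - 1` fail and every newcomer contacts the
other `d` among the first `d + t` nodes. -/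
def consecutiveFailure (n d t m : ℕ) (hn : d + t ≤ n) (hm : m ≤ d) : RepairEvent n d t where
  failed := (Finset.Ico m (m + t)).attachFin fun i hi => by
    have := Finset.mem_Ico.1 hi; omega
  card_failed := by simp
  helpers _ := (Finset.range (d + t) \ Finset.Ico m (m + t)).attachFin fun i hi => by
    have := Finset.mem_range.1 (Finset.mem_sdiff.1 hi).1; omega
  card_helpers _ := by
    rw [Finset.card_attachFin, Finset.card_sdiff_of_subset]
    · simp
    · intro i hi
      have := Finset.mem_Ico.1 hi
      exact Finset.mem_range.2 (by omega)
  helpers_live _ := by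
    rw [Finset.disjoint_left]
    intro a ha hb
    rw [Finset.mem_attachFin] at ha hb
    exact (Finset.mem_sdiff.1 ha).2 hb

theorem mem_failed_consecutiveFailure {n d t m : ℕ} {hn : d + t ≤ n} {hm : m ≤ d} {i : Fin n} :
    i ∈ (consecutiveFailure n d t m hn hm).failed ↔ m ≤ i.val ∧ i.val < m + t := by
  change i ∈ Finset.attachFin _ _ ↔ _
  rw [Finset.mem_attachFin, Finset.mem_Ico]

theorem mem_helpers_consecutiveFailure {n d t m : ℕ} {hn : d + t ≤ n} {hm : m ≤ d} {j}
    {i : Fin n} : i ∈ (consecutiveFailure n d t m hn hm).helpers j ↔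
      i.val < d + t ∧ ¬ (m ≤ i.val ∧ i.val < m + t) := by
  change i ∈ Finset.attachFin _ _ ↔ _
  rw [Finset.mem_attachFin, Finset.mem_sdiff, Finset.mem_range,
    Finset.mem_Ico]

/-- The cut-set bound for cooperative repair. If the nodes `ℓ, …, m - 1` are repaired one after
the other, each with the help of all its predecessors, then the contents of the first `ℓ` nodes
and `∑ (β (d - i) + β' (t - 1))` further symbols, those which the node `i` gets from the other
`d - i` helpers and from its `t - 1` peers, determine the contents of the first `m` nodes. -/
theorem CoopCode.exists_history_of_cut {F ι : Type*} {n d t α β β' ℓ : ℕ}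
    (C : CoopCode F ι n d t α β β') (hn : d + t ≤ n) (ht : 1 ≤ t) {m : ℕ} (hℓm : ℓ ≤ m)
    (hmd : m ≤ d) :
    ∃ (h : List (RepairEvent n d t)) (σ : Type) (_ : Fintype σ) (w : (ι → F) → σ → F),
      Fintype.card σ = ∑ i ∈ Finset.Ico ℓ m, (β * (d - i) + β' * (t - 1)) ∧
      ∀ f g, (∀ i : Fin n, i.val < ℓ → C.contents h f i = C.contents h g i) → w f = w g →
        ∀ i : Fin n, i.val < m → C.contents h f i = C.contents h g i := by
  induction m, hℓm using Nat.le_induction with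
  | base => exact ⟨[], Empty, inferInstance, fun _ => Empty.elim, by simp, fun f g h _ => h⟩
  | succ m hℓm ih =>
    obtain ⟨h, σ, _, w, hσ, hw⟩ := ih (by omega)
    let e := consecutiveFailure n d t m hn (by omega)
    let v : e.failed := ⟨⟨m, by omega⟩, mem_failed_consecutiveFailure.2 ⟨le_rfl, by simp; omega⟩⟩
    let down : (ι → F) → (i : e.failed) → e.helpers i → Fin β → F :=
      fun f i j => C.send h e i j (C.contents h f j)
    -- the helpers of node `m` that are not among its predecessors
    let far : Finset (Fin n) := (Finset.Ico (m + t) (d + t)).attachFin fun i hi => by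
      have := Finset.mem_Ico.1 hi; omega
    have hfar : ∀ j ∈ far, j ∈ e.helpers v := fun j hj => by
      rw [Finset.mem_attachFin, Finset.mem_Ico] at hj
      exact mem_helpers_consecutiveFailure.2 (by omega)
    have hold : ∀ (f) (i : Fin n), i.val < m → C.contents (e :: h) f i = C.contents h f i :=
      fun f i hi => by
        have : i ∉ e.failed := fun hi' => by
          have := mem_failed_consecutiveFailure.1 hi'; omega
        exact CoopCode.contents_cons_of_notMem C this
    refine ⟨e :: h, σ ⊕ (far × Fin β) ⊕ (e.Peer v × Fin β'), inferInstance,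
      fun f => Sum.elim (w f) (Sum.elim (fun p => down f v ⟨p.1.1, hfar _ p.1.2⟩ p.2)
        (fun p => C.coop h e p.1.1 v (down f p.1.1) p.2)), ?_, ?_⟩
    · have hP : Fintype.card (e.Peer v) = t - 1 := by
        rw [Fintype.card_subtype_compl, Fintype.card_coe, Fintype.card_unique, e.card_failed]
      have hF : Fintype.card far = d - m := by
        rw [Fintype.card_coe, Finset.card_attachFin, Nat.card_Ico]; omega
      rw [Finset.sum_Ico_succ_top hℓm, ← hσ]
      simp only [Fintype.card_sum, Fintype.card_prod, Fintype.card_fin, hP, hF]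
      ring
    · intro f g hfg hwfg
      have h1 : w f = w g := funext fun x => congrFun hwfg (Sum.inl x)
      have hpred := hw f g (fun i hi => by
        rw [← hold f i (by omega), ← hold g i (by omega)]; exact hfg i hi) h1
      have hdown : down f v = down g v := by
        funext j
        by_cases hj : j.1.val < m
        · simp only [down, hpred j.1 hj]
        · have hj' := mem_helpers_consecutiveFailure.1 j.2
          have hjf : j.1 ∈ far := by
            rw [Finset.mem_attachFin, Finset.mem_Ico]; omega
          exact funext fun s => congrFun hwfg (Sum.inr (Sum.inl (⟨j.1, hjf⟩, s)))
      intro i hi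
      rcases Nat.lt_succ_iff_lt_or_eq.1 hi with hi | hi
      · rw [hold f i hi, hold g i hi, hpred i hi]
      · obtain rfl : i = v.1 := Fin.ext hi
        rw [C.contents_cons_of_mem v, C.contents_cons_of_mem v]
        refine congrArg₂ (C.rebuild h e v) hdown ?_
        funext p s
        exact congrFun hwfg (Sum.inr (Sum.inr (p, s)))

/-- At the MBCR point, the total number of symbols that the nodes `ℓ, …, k - 1` contribute. -/
theorem sum_Ico_cut {d t ℓ k : ℕ} (ht : 1 ≤ t) (hℓ : ℓ ≤ k) (hkd : k ≤ d) :
    ∑ i ∈ Finset.Ico ℓ k, (2 * (d - i) + 1 * (t - 1)) =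
      k * (2 * d - k + t) - ℓ * (2 * d - ℓ + t) := by
  suffices h : ∑ i ∈ Finset.Ico ℓ k, (2 * (d - i) + 1 * (t - 1)) + ℓ * (2 * d - ℓ + t) =
      k * (2 * d - k + t) by omega
  induction k, hℓ using Nat.le_induction with
  | base => simp
  | succ k hℓ ih =>
    rw [Finset.sum_Ico_succ_top hℓ, add_right_comm, ih (by omega)]
    obtain ⟨c, rfl⟩ : ∃ c, d = k + 1 + c := ⟨d - (k + 1), by omega⟩
    obtain ⟨s, rfl⟩ : ∃ s, t = s + 1 := ⟨t - 1, by omega⟩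
    rw [show 2 * (k + 1 + c) - k = k + 2 + 2 * c by omega,
      show 2 * (k + 1 + c) - (k + 1) = k + 1 + 2 * c by omega,
      show k + 1 + c - k = 1 + c by omega, Nat.add_sub_cancel]
    ring

/-- If the observation `e` of the stored file is independent of the secure file, and if `e`
together with the symbols `w` determines the stored file, then there are at least as many symbols
in `w` as in the secure file. Indeed, for a value `b` of `e` that has positive probability, every
secure file `u` is stored with positive probability as a file `f` with `e f = b`, and
`u ↦ w f` is injective. -/
theorem card_le_of_mutualInfo_eq_zero {F ι κ σ B : Type*} [Fintype F] [Nontrivial F]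
    [Fintype κ] [DecidableEq κ] [Fintype σ] [Fintype B] {enc : (κ → F) → PMF (ι → F)}
    (hdec : ∃ dec : (ι → F) → (κ → F), ∀ u, ∀ f ∈ (enc u).support, dec f = u)
    {e : (ι → F) → B} {w : (ι → F) → σ → F}
    (hinj : ∀ f g, e f = e g → w f = w g → f = g)
    (h : mutualInfo (precodedLaw enc) Prod.fst (fun ω => e ω.2) = 0) :
    Fintype.card κ ≤ Fintype.card σ := by
  classical
  obtain ⟨dec, hdec⟩ := hdec
  obtain ⟨b, hb⟩ := ((precodedLaw enc).map fun ω => e ω.2).support_nonempty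
  have hex : ∀ u, ∃ f ∈ (enc u).support, e f = b := fun u => by
    obtain ⟨f₀, hf₀⟩ := (enc u).support_nonempty
    have hmem : ∀ u' f, (u', f) ∈ (precodedLaw enc).support ↔ f ∈ (enc u').support := by
      intro u' f
      simp [precodedLaw]
    have hu : u ∈ ((precodedLaw enc).map Prod.fst).support :=
      (PMF.mem_support_map_iff _ _ _).2 ⟨(u, f₀), (hmem u f₀).2 hf₀, rfl⟩
    have := mem_support_prod_of_mutualInfo_eq_zero h hu hb
    obtain ⟨⟨u', f⟩, hω, heq⟩ := (PMF.mem_support_map_iff _ _ _).1 this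
    obtain ⟨rfl, hf⟩ := Prod.ext_iff.1 heq
    exact ⟨f, (hmem _ _).1 hω, hf⟩
  choose f hf hfe using hex
  have hwf : Function.Injective fun u => w (f u) := fun u u' huu => by
    rw [← hdec u _ (hf u), ← hdec u' _ (hf u'),
      hinj (f u) (f u') ((hfe u).trans (hfe u').symm) huu]
  have := Fintype.card_le_of_injective _ hwf
  rw [Fintype.card_fun, Fintype.card_fun] at this
  exact (Nat.pow_le_pow_iff_right Fintype.one_lt_card).1 this

/-- The upper bound on the secure file size, for an arbitrary index set of the stored file, a finite one of
the secure file, and an arbitrary finite alphabet with at least two symbols. -/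
theorem MBCRCode.secureSize_le {F ι κ : Type*} [Fintype F] [Nontrivial F] [Fintype κ]
    [DecidableEq κ] {n k d t ℓ : ℕ} (hkd : k ≤ d) (ht : 1 ≤ t) (hn : d + t ≤ n) (hℓ : ℓ ≤ k)
    {C : MBCRCode F ι n d t} {enc : (κ → F) → PMF (ι → F)} (hC : C.RecoversFile k)
    (hs : C.IsSecure ℓ enc) :
    Fintype.card κ ≤ k * (2 * d - k + t) - ℓ * (2 * d - ℓ + t) := by
  obtain ⟨h, σ, _, w, hσ, hw⟩ := C.exists_history_of_cut hn ht hℓ hkd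
  rw [← sum_Ico_cut ht hℓ hkd, ← hσ]
  let K : Finset (Fin n) := (Finset.range k).attachFin fun i hi => by
    have := Finset.mem_range.1 hi; omega
  obtain ⟨D, hD⟩ := hC h K (by simp [K])
  -- the eavesdropper observes the first `ℓ` nodes at the end of the history
  let E : Finset (Fin (h.length + 1) × Fin n) :=
    {0} ×ˢ ((Finset.range ℓ).attachFin fun i hi => by
      have := Finset.mem_range.1 hi; omega)
  have hI := hs.2 h E (by simp [E])
  refine card_le_of_mutualInfo_eq_zero hs.1 (w := w)
    (e := fun f (v : E) => C.contents (h.drop v.1.1) f v.1.2) (fun f g hfg hwfg => ?_) hI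
  have hk := hw f g (fun i hi => by
    have := congrFun hfg ⟨(0, i), by simp [E, hi]⟩
    exact this) hwfg
  rw [← hD f, ← hD g]
  congr 1
  funext i
  exact hk i.1 (Finset.mem_range.1 ((Finset.mem_attachFin _).1 i.2))

/-! ### Arrays of coefficients -/

/-- A univariate polynomial of degree less than `m` with `m` roots vanishes, in terms of its
coefficients. -/
theorem eq_zero_of_sum_mul_pow_eq_zero {F ν : Type*} [Field F] {N m : ℕ} {x : ν → F}
    (hx : Function.Injective x) {S : Finset ν} (hS : m ≤ S.card) {c : Fin N → F}
    (hc : ∀ i : Fin N, m ≤ i.val → c i = 0) (h : ∀ s ∈ S, ∑ i, c i * x s ^ i.val = 0) : c = 0 := by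
  classical
  let p : F[X] := ∑ i : Fin N, Polynomial.monomial i.val (c i)
  have hp : p = 0 := by
    refine Polynomial.eq_zero_of_degree_lt_of_eval_index_eq_zero S (v := x) hx.injOn ?_ ?_
    · rw [Polynomial.degree_lt_iff_coeff_zero]
      intro a ha
      rw [Polynomial.finsetSum_coeff]
      refine Finset.sum_eq_zero fun i _ => ?_
      rw [Polynomial.coeff_monomial]
      split_ifs with hi
      · exact hc i (by omega)
      · rfl
    · intro s hs
      rw [Polynomial.eval_finsetSum]
      simpa [Polynomial.eval_monomial] using h s hs
  funext j
  have := congrArg (fun q => Polynomial.coeff q j.val) hp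
  simpa [p, Polynomial.finsetSum_coeff, Polynomial.coeff_monomial, Fin.val_inj] using this

/-- Polynomial interpolation: on a set of `ℓ ≤ N` points every power of `X` agrees with a
polynomial of degree less than `ℓ`. -/
theorem exists_reduction_of_pow {F ν : Type*} [Field F] {x : ν → F} (hx : Function.Injective x)
    (S : Finset ν) (N : ℕ) (hS : S.card ≤ N) :
    ∃ A : ℕ → Fin N → F, (∀ i (a : Fin N), S.card ≤ a.val → A i a = 0) ∧
      ∀ i, ∀ s ∈ S, ∑ a, A i a * x s ^ a.val = x s ^ i := by
  classical
  let p : ℕ → F[X] := fun i => Lagrange.interpolate S x fun s => x s ^ i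
  have hp : ∀ i, (p i).degree < S.card := fun i => Lagrange.degree_interpolate_lt _ hx.injOn
  refine ⟨fun i a => (p i).coeff a, fun i a ha =>
    Polynomial.coeff_eq_zero_of_degree_lt ((hp i).trans_le (by exact_mod_cast ha)), ?_⟩
  intro i s hs
  rw [Fin.sum_univ_eq_sum_range (fun a => (p i).coeff a * x s ^ a) N]
  have he : (p i).eval (x s) = x s ^ i := Lagrange.eval_interpolate_at_node _ hx.injOn hs
  rw [← he, Polynomial.eval_eq_sum, Polynomial.sum_over_range' _ (by simp) N]
  rcases eq_or_ne (p i) 0 with h0 | h0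
  · -- the zero polynomial has degree `⊥`, so that `N` could be `0` only if `S` were empty
    have : 0 < S.card := Finset.card_pos.2 ⟨s, hs⟩
    rw [h0, Polynomial.natDegree_zero]; omega
  · exact (Polynomial.natDegree_lt_iff_degree_lt h0).2 ((hp i).trans_le (by exact_mod_cast hS))

/-- The value at `(a, b)` of the bivariate polynomial with the array `c` of coefficients. -/
def arrayEval {F : Type*} [Field F] {d e : ℕ} (c : Fin d → Fin e → F) (a b : F) : F :=
  ∑ i, ∑ j, c i j * a ^ i.val * b ^ j.val

theorem arrayEval_add {F : Type*} [Field F] {d e : ℕ} (c c' : Fin d → Fin e → F) (a b : F) :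
    arrayEval (c + c') a b = arrayEval c a b + arrayEval c' a b := by
  simp [arrayEval, add_mul, Finset.sum_add_distrib]

theorem arrayEval_sub {F : Type*} [Field F] {d e : ℕ} (c c' : Fin d → Fin e → F) (a b : F) :
    arrayEval (c - c') a b = arrayEval c a b - arrayEval c' a b := by
  simp [arrayEval, sub_mul, Finset.sum_sub_distrib]

theorem arrayEval_eq_sum_left {F : Type*} [Field F] {d e : ℕ} (c : Fin d → Fin e → F) (a b : F) :
    arrayEval c a b = ∑ i, (∑ j, c i j * b ^ j.val) * a ^ i.val := by
  simp only [arrayEval, Finset.sum_mul]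
  exact Finset.sum_congr rfl fun i _ => Finset.sum_congr rfl fun j _ => by ring

theorem arrayEval_eq_sum_right {F : Type*} [Field F] {d e : ℕ} (c : Fin d → Fin e → F) (a b : F) :
    arrayEval c a b = ∑ j, (∑ i, c i j * a ^ i.val) * b ^ j.val := by
  simp only [arrayEval, Finset.sum_mul]
  exact Finset.sum_comm

theorem arrayEval_left_eq_zero {F ν : Type*} [Field F] {d e : ℕ} {c : Fin d → Fin e → F}
    {x : ν → F} (hx : Function.Injective x) {S : Finset ν} (hS : d ≤ S.card) {b : F}
    (h : ∀ s ∈ S, arrayEval c (x s) b = 0) (a : F) : arrayEval c a b = 0 := by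
  have := eq_zero_of_sum_mul_pow_eq_zero hx hS (c := fun i => ∑ j, c i j * b ^ j.val)
    (fun i hi => by omega) (fun s hs => by rw [← arrayEval_eq_sum_left]; exact h s hs)
  rw [arrayEval_eq_sum_left]
  exact Finset.sum_eq_zero fun i _ => by rw [congrFun this i, Pi.zero_apply, zero_mul]

theorem arrayEval_right_eq_zero {F ν : Type*} [Field F] {d e : ℕ} {c : Fin d → Fin e → F}
    {y : ν → F} (hy : Function.Injective y) {S : Finset ν} (hS : e ≤ S.card) {a : F}
    (h : ∀ s ∈ S, arrayEval c a (y s) = 0) (b : F) : arrayEval c a b = 0 := by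
  have := eq_zero_of_sum_mul_pow_eq_zero hy hS (c := fun j => ∑ i, c i j * a ^ i.val)
    (fun i hi => by omega) (fun s hs => by rw [← arrayEval_eq_sum_right]; exact h s hs)
  rw [arrayEval_eq_sum_right]
  exact Finset.sum_eq_zero fun i _ => by rw [congrFun this i, Pi.zero_apply, zero_mul]

/-- An array supported on the indices `(i, j)` with `i < k` or `j < k` vanishes if its polynomial
vanishes on `k` vertical and on `k` horizontal lines. -/
theorem array_eq_zero_of_lines {F : Type*} [Field F] {n d e k : ℕ} {x y : Fin n → F}
    (hx : Function.Injective x) (hy : Function.Injective y) (hd : d ≤ n) (he : e ≤ n)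
    {c : Fin d → Fin e → F} (hc : ∀ i j, k ≤ i.val → k ≤ j.val → c i j = 0)
    {K : Finset (Fin n)} (hK : k ≤ K.card) (hX : ∀ s ∈ K, ∀ b, arrayEval c (x s) b = 0)
    (hY : ∀ s ∈ K, ∀ a, arrayEval c a (y s) = 0) : c = 0 := by
  have hrow : ∀ s ∈ K, (fun i => ∑ j, c i j * y s ^ j.val) = 0 := fun s hs =>
    eq_zero_of_sum_mul_pow_eq_zero hx (S := Finset.univ) (m := d) (by simpa using hd)
      (fun i hi => by omega) (fun s' _ => by rw [← arrayEval_eq_sum_left]; exact hY s hs _)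
  have hcol : ∀ s ∈ K, (fun j => ∑ i, c i j * x s ^ i.val) = 0 := fun s hs =>
    eq_zero_of_sum_mul_pow_eq_zero hy (S := Finset.univ) (m := e) (by simpa using he)
      (fun i hi => by omega) (fun s' _ => by rw [← arrayEval_eq_sum_right]; exact hX s hs _)
  have hlow : ∀ i : Fin d, k ≤ i.val → c i = 0 := fun i hi =>
    eq_zero_of_sum_mul_pow_eq_zero hy hK (fun j hj => hc i j hi hj)
      (fun s hs => congrFun (hrow s hs) i)
  funext i j
  exact congrFun (eq_zero_of_sum_mul_pow_eq_zero hx hK (c := fun i => c i j)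
    (fun i hi => congrFun (hlow i hi) j) (fun s hs => congrFun (hcol s hs) j)) i

theorem arrayEval_reduce_left {F : Type*} [Field F] {d e : ℕ} {A : ℕ → Fin d → F} {a : F}
    (h : ∀ i, ∑ i', A i i' * a ^ i'.val = a ^ i) (c : Fin d → Fin e → F) (b : F) :
    arrayEval (fun i' j => ∑ i : Fin d, c i j * A i i') a b = arrayEval c a b := by
  rw [arrayEval_eq_sum_right, arrayEval_eq_sum_right]
  refine Finset.sum_congr rfl fun j _ => congrArg (· * b ^ j.val) ?_
  simp only [Finset.sum_mul]
  rw [Finset.sum_comm]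
  refine Finset.sum_congr rfl fun i _ => ?_
  rw [← h i, Finset.mul_sum]
  exact Finset.sum_congr rfl fun i' _ => mul_assoc _ _ _

theorem arrayEval_reduce_right {F : Type*} [Field F] {d e : ℕ} {B : ℕ → Fin e → F} {b : F}
    (h : ∀ j, ∑ j', B j j' * b ^ j'.val = b ^ j) (c : Fin d → Fin e → F) (a : F) :
    arrayEval (fun i j' => ∑ j : Fin e, c i j * B j j') a b = arrayEval c a b := by
  rw [arrayEval_eq_sum_left, arrayEval_eq_sum_left]
  refine Finset.sum_congr rfl fun i _ => congrArg (· * a ^ i.val) ?_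
  simp only [Finset.sum_mul]
  rw [Finset.sum_comm]
  refine Finset.sum_congr rfl fun j _ => ?_
  rw [← h j, Finset.mul_sum]
  exact Finset.sum_congr rfl fun j' _ => mul_assoc _ _ _

/-- Every bivariate polynomial agrees on the lines `X = x s` and `Y = y s`, for `s` in a set of at
most `ℓ` indices, with one that has only the monomials `X ^ i * Y ^ j` with `i < ℓ` or `j < ℓ`.
If `P` and `Q` are the reductions of the polynomial in `X` and in `Y`, and `R` is its reduction in
both variables, then this is `P + Q - R`. -/
theorem exists_array_eq_on_lines {F ν : Type*} [Field F] {d e ℓ : ℕ} {x y : ν → F}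
    (hx : Function.Injective x) (hy : Function.Injective y) (hd : ℓ ≤ d) (he : ℓ ≤ e)
    {S : Finset ν} (hS : S.card ≤ ℓ) (c : Fin d → Fin e → F) :
    ∃ c' : Fin d → Fin e → F, (∀ i j, ℓ ≤ i.val → ℓ ≤ j.val → c' i j = 0) ∧
      ∀ s ∈ S, (∀ b, arrayEval c' (x s) b = arrayEval c (x s) b) ∧
        ∀ a, arrayEval c' a (y s) = arrayEval c a (y s) := by
  obtain ⟨A, hA0, hA⟩ := exists_reduction_of_pow hx S d (hS.trans hd)
  obtain ⟨B, hB0, hB⟩ := exists_reduction_of_pow hy S e (hS.trans he)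
  let X : (Fin d → Fin e → F) → Fin d → Fin e → F := fun c i' j => ∑ i : Fin d, c i j * A i i'
  let Y : (Fin d → Fin e → F) → Fin d → Fin e → F := fun c i j' => ∑ j : Fin e, c i j * B j j'
  have hX : ∀ s ∈ S, ∀ c b, arrayEval (X c) (x s) b = arrayEval c (x s) b :=
    fun s hs => arrayEval_reduce_left fun i => hA i s hs
  have hY : ∀ s ∈ S, ∀ c a, arrayEval (Y c) a (y s) = arrayEval c a (y s) :=
    fun s hs => arrayEval_reduce_right fun i => hB i s hs
  have hXY : Y (X c) = X (Y c) := by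
    funext i j
    simp only [X, Y, Finset.sum_mul]
    rw [Finset.sum_comm]
    exact Finset.sum_congr rfl fun _ _ => Finset.sum_congr rfl fun _ _ => mul_right_comm _ _ _
  refine ⟨X c + Y c - Y (X c), fun i j hi hj => ?_, fun s hs => ⟨fun b => ?_, fun a => ?_⟩⟩
  · simp [X, Y, hA0 _ i (hS.trans hi), hB0 _ j (hS.trans hj)]
  · rw [arrayEval_sub, arrayEval_add, hXY, hX s hs, hX s hs, add_sub_cancel_right]
  · rw [arrayEval_sub, arrayEval_add, hY s hs, hY s hs, add_sub_cancel_left]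

/-! ### The code polynomial and the contents of a node -/

/-- The coefficients of the code polynomial as an array that is extended by zero to all exponents
`(i, j)` with `i < d` and `j < d + t`. -/
def coeffArray {F : Type*} [Field F] {d t k : ℕ} (f : CodeMonomial d t k → F) :
    Fin d → Fin (d + t) → F :=
  fun i j => if h : i.val < k ∨ j.val < k then f ⟨(i, j), h⟩ else 0

theorem coeffArray_apply {F : Type*} [Field F] {d t k : ℕ} (f : CodeMonomial d t k → F)
    (p : CodeMonomial d t k) : coeffArray f p.1.1 p.1.2 = f p := dif_pos p.2

theorem coeffArray_eq_zero {F : Type*} [Field F] {d t k : ℕ} (f : CodeMonomial d t k → F)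
    (i : Fin d) (j : Fin (d + t)) (hi : k ≤ i.val) (hj : k ≤ j.val) : coeffArray f i j = 0 :=
  dif_neg (by omega)

theorem coeffArray_injective {F : Type*} [Field F] {d t k : ℕ} :
    Function.Injective (coeffArray : (CodeMonomial d t k → F) → _) := fun f g h => by
  funext p
  rw [← coeffArray_apply f, ← coeffArray_apply g, h]

theorem coeffArray_add {F : Type*} [Field F] {d t k : ℕ} (f g : CodeMonomial d t k → F) :
    coeffArray (f + g) = coeffArray f + coeffArray g := by
  funext i j
  simp only [coeffArray, Pi.add_apply]
  split_ifs <;> simp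

/-- The monomials of the random symbols are those of a code polynomial with `ℓ` in place of
`k`. -/
theorem coeffArray_fillCoeffs {F : Type*} [Field F] {d t k ℓ : ℕ} (hℓ : ℓ ≤ k)
    (u : DataMonomial d t k ℓ → F) (r : CodeMonomial d t ℓ → F) :
    coeffArray (fillCoeffs u r : CodeMonomial d t k → F) =
      coeffArray (fillCoeffs u 0 : CodeMonomial d t k → F) + coeffArray r := by
  funext i j
  simp only [coeffArray, fillCoeffs, Pi.add_apply]
  by_cases h : i.val < ℓ ∨ j.val < ℓ
  · have h' : i.val < k ∨ j.val < k := by omega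
    simp [h, h']
  · simp [h]

theorem coeffArray_fillCoeffs_zero {F : Type*} [Field F] {d t k ℓ : ℕ} (hℓ : ℓ ≤ k)
    (r : CodeMonomial d t ℓ → F) :
    coeffArray (fillCoeffs 0 r : CodeMonomial d t k → F) = coeffArray r := by
  rw [coeffArray_fillCoeffs hℓ, add_eq_right]
  funext i j
  simp [coeffArray, fillCoeffs]

theorem codePoly_eq_sum {F : Type*} [Field F] {d t k : ℕ} (f : CodeMonomial d t k → F) :
    codePoly f = ∑ i : Fin d, ∑ j : Fin (d + t),
      Polynomial.monomial j.val (Polynomial.monomial i.val (coeffArray f i j)) := by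
  rw [← Fintype.sum_prod_type' fun (i : Fin d) (j : Fin (d + t)) =>
      Polynomial.monomial j.val (Polynomial.monomial i.val (coeffArray f i j)),
    ← Fintype.sum_subtype_add_sum_subtype
      (fun p : Fin d × Fin (d + t) => p.1.val < k ∨ p.2.val < k)]
  rw [Finset.sum_eq_zero (s := (Finset.univ : Finset
    {p : Fin d × Fin (d + t) // ¬ (p.1.val < k ∨ p.2.val < k)})), add_zero, codePoly]
  · exact Finset.sum_congr rfl fun p _ => by rw [coeffArray_apply]
  · intro p _
    rw [coeffArray, dif_neg p.2, map_zero, map_zero]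

theorem evalEval_codePoly {F : Type*} [Field F] {d t k : ℕ} (f : CodeMonomial d t k → F)
    (a b : F) : (codePoly f).evalEval a b = arrayEval (coeffArray f) a b := by
  simp only [codePoly_eq_sum, arrayEval, Polynomial.evalEval_finsetSum]
  refine Finset.sum_congr rfl fun i _ => Finset.sum_congr rfl fun j _ => ?_
  rw [Polynomial.evalEval, Polynomial.eval_monomial, ← Polynomial.C_pow, Polynomial.eval_mul,
    Polynomial.eval_C, Polynomial.eval_monomial]

theorem codePoly_fillCoeffs_sub {F : Type*} [Field F] {d t k ℓ : ℕ} (hℓ : ℓ ≤ k)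
    (u : DataMonomial d t k ℓ → F) (r : CodeMonomial d t ℓ → F) :
    codePoly (fillCoeffs u r : CodeMonomial d t k → F) -
      codePoly (fillCoeffs u 0 : CodeMonomial d t k → F) = codePoly r := by
  simp only [codePoly_eq_sum, ← Finset.sum_sub_distrib, ← map_sub]
  rw [coeffArray_fillCoeffs hℓ u r]
  simp

theorem cyclicAdd_injOn {n : ℕ} (i : Fin n) : Set.InjOn (cyclicAdd i) (Set.Iio n) := by
  intro s hs s' hs' h
  have h1 : (i.val + s) % n = (i.val + s') % n := congrArg Fin.val h
  exact Nat.ModEq.eq_of_lt_of_lt (Nat.ModEq.add_left_cancel' i.val h1) hs hs'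

theorem card_image_cyclicAdd {n m : ℕ} (i : Fin n) (hm : m ≤ n) :
    ((Finset.range m).image (cyclicAdd i)).card = m := by
  rw [Finset.card_image_of_injOn, Finset.card_range]
  exact (cyclicAdd_injOn i).mono fun s hs => lt_of_lt_of_le (Finset.mem_range.1 hs) hm

/-- The contents of node `i` amount to the restrictions of the code polynomial to the lines
`X = x i` and `Y = y i`. -/
theorem polyEncode_eq_iff {F : Type*} [Field F] {n d t k : ℕ} {x y : Fin n → F}
    (hx : Function.Injective x) (hy : Function.Injective y) (hd : 1 ≤ d)
    (hn : d + t ≤ n) {f g : CodeMonomial d t k → F} {i : Fin n} :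
    polyEncode x y f i = polyEncode x y g i ↔
      (∀ b, arrayEval (coeffArray f) (x i) b = arrayEval (coeffArray g) (x i) b) ∧
      ∀ a, arrayEval (coeffArray f) a (y i) = arrayEval (coeffArray g) a (y i) := by
  constructor
  · intro h
    simp only [← sub_eq_zero (b := arrayEval (coeffArray g) _ _), ← arrayEval_sub]
    have hX : ∀ b, arrayEval (coeffArray f - coeffArray g) (x i) b = 0 := by
      refine arrayEval_right_eq_zero hy (card_image_cyclicAdd i hn).ge fun j hj => ?_
      obtain ⟨s, hs, rfl⟩ := Finset.mem_image.1 hj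
      rw [Finset.mem_range] at hs
      have := congrFun h ⟨s, by omega⟩
      simpa only [polyEncode, if_pos hs, evalEval_codePoly, ← sub_eq_zero (b := arrayEval _ _ _),
        ← arrayEval_sub] using this
    refine ⟨hX, arrayEval_left_eq_zero hx (card_image_cyclicAdd i (m := d) (by omega)).ge
      fun j hj => ?_⟩
    obtain ⟨s, hs, rfl⟩ := Finset.mem_image.1 hj
    rw [Finset.mem_range] at hs
    rcases Nat.eq_zero_or_pos s with rfl | hs0
    · -- the value at `(x i, y i)` is stored only once, in the first part of the contents
      have : cyclicAdd i 0 = i := Fin.ext (Nat.mod_eq_of_lt i.isLt)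
      rw [this]
      exact hX _
    · have := congrFun h ⟨d + t + s - 1, by omega⟩
      simp only [polyEncode, evalEval_codePoly] at this
      rw [if_neg (by omega), if_neg (by omega),
        show d + t + s - 1 - (d + t) + 1 = s by omega, ← sub_eq_zero, ← arrayEval_sub] at this
      exact this
  · rintro ⟨hX, hY⟩
    funext s
    simp only [polyEncode, evalEval_codePoly, hX, hY]

/-! ### Exact repair -/

/-- The two symbols `F(x_j, y_i)` and `F(x_i, y_j)` which the newcomer `i` downloads from the
helper `j`. -/
def polyDownload {F : Type*} [Field F] {n d t k : ℕ} (x y : Fin n → F)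
    (f : CodeMonomial d t k → F) (i j : Fin n) : Fin 2 → F :=
  ![arrayEval (coeffArray f) (x j) (y i), arrayEval (coeffArray f) (x i) (y j)]

/-- The code with the bivariate polynomials. The newcomer `i` downloads `F(x_j, y_i)` and
`F(x_i, y_j)` from each helper `j`, and receives `F(x_i, y_{i'})` from each other newcomer `i'`.
Every one of these symbols, as well as the contents that are rebuilt, is a function of data that
are available to the sender; `Function.extend` is used to choose that function, whose values
outside the range of the data are irrelevant. -/
noncomputable def polyCode {F : Type*} [Field F] {n d t k : ℕ} (x y : Fin n → F) :
    MBCRCode F (CodeMonomial d t k) n d t where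
  encode := polyEncode x y
  send _ _ i j := Function.extend (fun f : CodeMonomial d t k → F => polyEncode x y f j)
    (fun f => polyDownload x y f i j) 0
  coop _ e i' i := Function.extend
    (fun (f : CodeMonomial d t k → F) (j : e.helpers i') => polyDownload x y f i' j)
    (fun f _ => arrayEval (coeffArray f) (x i) (y i')) 0
  rebuild _ e i m m' := Function.extend
    (fun f : CodeMonomial d t k → F => ((fun (j : e.helpers i) => polyDownload x y f i j),
      fun (i' : e.Peer i) (_ : Fin 1) => arrayEval (coeffArray f) (x i) (y i'.1)))
    (fun f => polyEncode x y f i) 0 (m, m')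

/-- The downloads of the newcomer `i` determine the code polynomial on the line `Y = y i`, where
its degree in `X` is less than the number `d` of helpers. -/
theorem arrayEval_eq_of_polyDownload_eq {F : Type*} [Field F] {n d t k : ℕ} {x y : Fin n → F}
    (hx : Function.Injective x) {f g : CodeMonomial d t k → F} {e : RepairEvent n d t}
    {i : e.failed} (h : ∀ j ∈ e.helpers i, polyDownload x y f i j = polyDownload x y g i j)
    (a : F) : arrayEval (coeffArray f) a (y i) = arrayEval (coeffArray g) a (y i) := by
  rw [← sub_eq_zero, ← arrayEval_sub]
  refine arrayEval_left_eq_zero hx (e.card_helpers i).ge (fun j hj => ?_) a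
  rw [arrayEval_sub, sub_eq_zero]
  exact congrFun (h j hj) 0

/-- The downloads of the newcomer `i` and what it receives from the other newcomers determine its
contents: on the line `X = x i` the code polynomial is known at the points `y j` of the `d`
helpers and of all `t` newcomers, including `i` itself, and its degree in `Y` is less than
`d + t`. -/
theorem polyEncode_eq_of_received_eq {F : Type*} [Field F] {n d t k : ℕ} {x y : Fin n → F}
    (hx : Function.Injective x) (hy : Function.Injective y) (hd : 1 ≤ d) (hn : d + t ≤ n)
    {f g : CodeMonomial d t k → F} {e : RepairEvent n d t} {i : e.failed}
    (h : ∀ j ∈ e.helpers i, polyDownload x y f i j = polyDownload x y g i j)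
    (h' : ∀ i' : e.Peer i, arrayEval (coeffArray f) (x i) (y i'.1) =
      arrayEval (coeffArray g) (x i) (y i'.1)) :
    polyEncode x y f i = polyEncode x y g i := by
  have hY := arrayEval_eq_of_polyDownload_eq hx h
  refine (polyEncode_eq_iff hx hy hd hn).2 ⟨fun b => ?_, hY⟩
  rw [← sub_eq_zero, ← arrayEval_sub]
  have hcard : (e.helpers i ∪ e.failed).card = d + t := by
    rw [Finset.card_union_of_disjoint (e.helpers_live i), e.card_helpers, e.card_failed]
  refine arrayEval_right_eq_zero hy hcard.ge (fun j hj => ?_) b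
  rw [arrayEval_sub, sub_eq_zero]
  rcases Finset.mem_union.1 hj with hj | hj
  · exact congrFun (h j hj) 1
  · by_cases hji : (⟨j, hj⟩ : e.failed) = i
    · have hj' : j = i.1 := congrArg Subtype.val hji
      rw [hj']
      exact hY _
    · exact h' ⟨⟨j, hj⟩, hji⟩

theorem polyCode_isExactRepair {F : Type*} [Field F] {n d t k : ℕ} {x y : Fin n → F}
    (hx : Function.Injective x) (hy : Function.Injective y) (hd : 1 ≤ d) (hn : d + t ≤ n) :
    (polyCode x y : MBCRCode F (CodeMonomial d t k) n d t).IsExactRepair := by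
  intro h f
  induction h with
  | nil => rfl
  | cons e h ih =>
    funext i
    by_cases hi : i ∈ e.failed
    · have hsend : ∀ (v : e.failed) (j : e.helpers v),
          (polyCode x y : MBCRCode F (CodeMonomial d t k) n d t).send h e v j
            (polyEncode x y f j) = polyDownload x y f v j := fun v j => by
        dsimp only [polyCode]
        refine Function.FactorsThrough.extend_apply (fun f g hfg => ?_) _ f
        obtain ⟨hX, hY⟩ := (polyEncode_eq_iff hx hy hd hn).1 hfg
        simp only [polyDownload, hX, hY]
      have hcoop : ∀ v' v : e.failed,
          (polyCode x y : MBCRCode F (CodeMonomial d t k) n d t).coop h e v' v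
            (fun j => polyDownload x y f v' j) =
          fun _ => arrayEval (coeffArray f) (x v) (y v') := fun v' v => by
        dsimp only [polyCode]
        refine Function.FactorsThrough.extend_apply (fun f g hfg => ?_) _ f
        funext _
        exact arrayEval_eq_of_polyDownload_eq hx (fun j hj => congrFun hfg ⟨j, hj⟩) _
      refine (CoopCode.contents_cons_of_mem _ ⟨i, hi⟩).trans ?_
      have henc : (polyCode x y : MBCRCode F (CodeMonomial d t k) n d t).encode f =
        polyEncode x y f := rfl
      simp only [ih, henc, hsend, hcoop]
      dsimp only [polyCode]
      refine Function.FactorsThrough.extend_apply (fun f g hfg => ?_) _ f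
      obtain ⟨h1, h2⟩ := Prod.ext_iff.1 hfg
      exact polyEncode_eq_of_received_eq hx hy hd hn (i := ⟨i, hi⟩)
        (fun j hj => congrFun h1 ⟨j, hj⟩) (fun i' => congrFun (congrFun h2 i') 0)
    · rw [CoopCode.contents_cons_of_notMem _ hi, ih]

/-- Two coefficient arrays that agree outside the indices `(i, j)` with `i < m` or `j < m` are equal
if the contents of `m` nodes agree. -/
theorem coeffArray_eq_of_polyEncode_eq {F : Type*} [Field F] {n d t k m : ℕ} {x y : Fin n → F}
    (hx : Function.Injective x) (hy : Function.Injective y) (hd : 1 ≤ d) (hn : d + t ≤ n)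
    {f g : CodeMonomial d t k → F} {K : Finset (Fin n)} (hK : K.card = m)
    (h : ∀ i ∈ K, polyEncode x y f i = polyEncode x y g i)
    (hfg : ∀ i j, m ≤ i.val → m ≤ j.val → coeffArray f i j = coeffArray g i j) :
    coeffArray f = coeffArray g := by
  rw [← sub_eq_zero]
  refine array_eq_zero_of_lines hx hy (by omega) hn (K := K) (fun i j hi hj => ?_) hK.ge
    (fun s hs b => ?_) (fun s hs a => ?_)
  · rw [Pi.sub_apply, Pi.sub_apply, hfg i j hi hj, sub_self]
  · rw [arrayEval_sub, ((polyEncode_eq_iff hx hy hd hn).1 (h s hs)).1, sub_self]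
  · rw [arrayEval_sub, ((polyEncode_eq_iff hx hy hd hn).1 (h s hs)).2, sub_self]

theorem polyCode_recoversFile {F : Type*} [Field F] {n d t k : ℕ} {x y : Fin n → F}
    (hx : Function.Injective x) (hy : Function.Injective y) (hd : 1 ≤ d) (hn : d + t ≤ n) :
    (polyCode x y : MBCRCode F (CodeMonomial d t k) n d t).RecoversFile k := by
  intro h K hK
  simp only [polyCode_isExactRepair hx hy hd hn h]
  have hinj : Function.Injective fun (f : CodeMonomial d t k → F) (i : K) =>
      polyEncode x y f i := fun f g hfg =>
    coeffArray_injective (coeffArray_eq_of_polyEncode_eq hx hy hd hn hK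
      (fun i hi => congrFun hfg ⟨i, hi⟩)
      fun i j hi hj => by rw [coeffArray_eq_zero f i j hi hj, coeffArray_eq_zero g i j hi hj])
  exact ⟨Function.invFun _, Function.leftInverse_invFun hinj⟩

/-! ### Secrecy -/

theorem exists_decoder_of_randomness {F : Type*} [Field F] {n d t k ℓ : ℕ} {x y : Fin n → F}
    (hx : Function.Injective x) (hy : Function.Injective y) (hd : 1 ≤ d) (hn : d + t ≤ n)
    (hℓ : ℓ ≤ k) {E : Finset (Fin n)} (hE : E.card = ℓ) :
    ∃ D : (DataMonomial d t k ℓ → F) → (E → Fin (2 * d + t - 1) → F) → (CodeMonomial d t ℓ → F),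
      ∀ u r, D u (fun i => polyEncode x y (fillCoeffs u r : CodeMonomial d t k → F) i) = r := by
  have hinj : ∀ u, Function.Injective fun (r : CodeMonomial d t ℓ → F) (i : E) =>
      polyEncode x y (fillCoeffs u r : CodeMonomial d t k → F) i := fun u r r' h => by
    have := coeffArray_eq_of_polyEncode_eq hx hy hd hn hE (fun i hi => congrFun h ⟨i, hi⟩)
      fun i j hi hj => by
        rw [coeffArray_fillCoeffs hℓ, coeffArray_fillCoeffs hℓ u r', Pi.add_apply, Pi.add_apply,
          Pi.add_apply, Pi.add_apply, coeffArray_eq_zero r i j hi hj,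
          coeffArray_eq_zero r' i j hi hj]
    rw [coeffArray_fillCoeffs hℓ, coeffArray_fillCoeffs hℓ u r', add_right_inj] at this
    exact coeffArray_injective this
  exact ⟨fun u => Function.invFun _, fun u => Function.leftInverse_invFun (hinj u)⟩

/-- At `ℓ` nodes, changing the data symbols has the same effect as a translation of the random
symbols. -/
theorem exists_randomness_shift {F : Type*} [Field F] {n d t k ℓ : ℕ} {x y : Fin n → F}
    (hx : Function.Injective x) (hy : Function.Injective y) (hd : 1 ≤ d) (hn : d + t ≤ n)
    (hℓ : ℓ ≤ k) (hkd : k ≤ d) {E : Finset (Fin n)} (hE : E.card ≤ ℓ)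
    (u : DataMonomial d t k ℓ → F) :
    ∃ ρ : CodeMonomial d t ℓ → F, ∀ r, ∀ i ∈ E,
      polyEncode x y (fillCoeffs u r : CodeMonomial d t k → F) i =
        polyEncode x y (fillCoeffs 0 (r + ρ) : CodeMonomial d t k → F) i := by
  obtain ⟨c, hc0, hc⟩ := exists_array_eq_on_lines hx hy (hℓ.trans hkd)
    ((hℓ.trans hkd).trans (Nat.le_add_right d t)) hE
    (coeffArray (fillCoeffs u 0 : CodeMonomial d t k → F))
  have hρ : coeffArray (fun p : CodeMonomial d t ℓ => c p.1.1 p.1.2) = c := by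
    funext i j
    rw [coeffArray]
    split_ifs with h
    · rfl
    · exact (hc0 i j (by omega) (by omega)).symm
  refine ⟨fun p => c p.1.1 p.1.2, fun r i hi => (polyEncode_eq_iff hx hy hd hn).2 ⟨fun b => ?_,
    fun a => ?_⟩⟩
  · rw [coeffArray_fillCoeffs hℓ, coeffArray_fillCoeffs_zero hℓ, coeffArray_add, hρ,
      arrayEval_add, arrayEval_add, (hc i hi).1, add_comm]
  · rw [coeffArray_fillCoeffs hℓ, coeffArray_fillCoeffs_zero hℓ, coeffArray_add, hρ,
      arrayEval_add, arrayEval_add, (hc i hi).2, add_comm]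

theorem PMF.map_uniformOfFintype_equiv {A B : Type*} [Fintype A] [Nonempty A] [Fintype B]
    [Nonempty B] (e : A ≃ B) : (PMF.uniformOfFintype A).map e = PMF.uniformOfFintype B := by
  classical
  ext b
  rw [PMF.map_apply, tsum_eq_single (e.symm b)]
  · simp [Fintype.card_congr e]
  · intro a ha
    rw [if_neg]
    rintro rfl
    simp at ha

/-- A form of secrecy that is stronger than `CoopCode.IsSecure` and free of entropies: the
conditional law of what the eavesdropper observes, given the secure file, does not depend on the
secure file. -/
def CoopCode.IsPerfectlySecret {F ι κ : Type*} {n d t α β β' : ℕ}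
    (C : CoopCode F ι n d t α β β') (ℓ : ℕ) (enc : (κ → F) → PMF (ι → F)) : Prop :=
  (∃ dec : (ι → F) → (κ → F), ∀ u, ∀ f ∈ (enc u).support, dec f = u) ∧
  ∀ (h : List (RepairEvent n d t)) (E : Finset (Fin (h.length + 1) × Fin n)), E.card = ℓ →
    ∃ μ, ∀ u, (enc u).map (fun f (v : E) => C.contents (h.drop v.1.1) f v.1.2) = μ

theorem CoopCode.IsPerfectlySecret.isSecure {F ι κ : Type*} {n d t α β β' : ℕ} [Fintype F]
    [Nonempty F] [Fintype κ] [DecidableEq κ] {C : CoopCode F ι n d t α β β'} {ℓ : ℕ}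
    {enc : (κ → F) → PMF (ι → F)} (hs : C.IsPerfectlySecret ℓ enc) : C.IsSecure ℓ enc := by
  refine ⟨hs.1, fun h E hE => ?_⟩
  obtain ⟨μ, hμ⟩ := hs.2 h E hE
  exact mutualInfo_precodedLaw_eq_zero
    (Y := fun f (v : E) => C.contents (h.drop v.1.1) f v.1.2) hμ

theorem polyCode_isPerfectlySecret {F : Type*} [Field F] [Fintype F] {n d t k ℓ : ℕ}
    {x y : Fin n → F} (hx : Function.Injective x) (hy : Function.Injective y) (hd : 1 ≤ d)
    (hn : d + t ≤ n) (hℓ : ℓ ≤ k) (hkd : k ≤ d) :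
    (polyCode x y : MBCRCode F (CodeMonomial d t k) n d t).IsPerfectlySecret ℓ
      (randomFill : (DataMonomial d t k ℓ → F) → PMF (CodeMonomial d t k → F)) := by
  refine ⟨⟨fun f p => f ⟨p.1, p.2.1⟩, fun u f hf => ?_⟩, fun h E hE => ?_⟩
  · obtain ⟨r, -, rfl⟩ := (PMF.mem_support_map_iff _ _ _).1 hf
    funext p
    exact dif_neg p.2.2
  · refine ⟨(randomFill (0 : DataMonomial d t k ℓ → F)).map
      fun (f : CodeMonomial d t k → F) (v : E) => polyEncode x y f v.1.2, fun u => ?_⟩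
    simp only [polyCode_isExactRepair hx hy hd hn (h.drop _)]
    obtain ⟨ρ, hρ⟩ := exists_randomness_shift hx hy hd hn hℓ hkd
      (Finset.card_image_le.trans hE.le : (E.image Prod.snd).card ≤ ℓ) u
    rw [randomFill, randomFill, PMF.map_comp, PMF.map_comp]
    conv_rhs => rw [← PMF.map_uniformOfFintype_equiv (Equiv.addRight ρ), PMF.map_comp]
    congr 1
    funext r v
    exact hρ r v.1.2 (Finset.mem_image_of_mem _ v.2)

/-! ### Change of the index sets -/

/-- The same coding scheme for files that are indexed by `ι'` instead of `ι`. -/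
def CoopCode.reindex {F ι ι' : Type*} {n d t α β β' : ℕ} (C : CoopCode F ι n d t α β β')
    (e : ι ≃ ι') : CoopCode F ι' n d t α β β' where
  encode f := C.encode (f ∘ e)
  send := C.send
  coop := C.coop
  rebuild := C.rebuild

theorem CoopCode.contents_reindex {F ι ι' : Type*} {n d t α β β' : ℕ}
    (C : CoopCode F ι n d t α β β') (e : ι ≃ ι') (h : List (RepairEvent n d t)) (f : ι' → F) :
    (C.reindex e).contents h f = C.contents h (f ∘ e) := by
  induction h with
  | nil => rfl
  | cons a h ih =>
    funext i
    simp only [CoopCode.contents, ih]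
    rfl

theorem CoopCode.RecoversFile.reindex {F ι ι' : Type*} {n d t α β β' k : ℕ}
    {C : CoopCode F ι n d t α β β'} (hC : C.RecoversFile k) (e : ι ≃ ι') :
    (C.reindex e).RecoversFile k := by
  intro h K hK
  obtain ⟨D, hD⟩ := hC h K hK
  refine ⟨fun c => D c ∘ e.symm, fun f => ?_⟩
  simp only [CoopCode.contents_reindex, hD]
  funext i
  simp

theorem CoopCode.IsExactRepair.reindex {F ι ι' : Type*} {n d t α β β' : ℕ}
    {C : CoopCode F ι n d t α β β'} (hC : C.IsExactRepair) (e : ι ≃ ι') :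
    (C.reindex e).IsExactRepair := fun h f => by
  rw [CoopCode.contents_reindex, hC]
  rfl

theorem CoopCode.IsPerfectlySecret.reindex {F ι ι' κ κ' : Type*} {n d t α β β' ℓ : ℕ}
    {C : CoopCode F ι n d t α β β'} {enc : (κ → F) → PMF (ι → F)}
    (hs : C.IsPerfectlySecret ℓ enc) (e : ι ≃ ι') (σ : κ ≃ κ') :
    (C.reindex e).IsPerfectlySecret ℓ
      (fun u : κ' → F => (enc (u ∘ σ)).map fun f => f ∘ e.symm) := by
  obtain ⟨⟨dec, hdec⟩, hs⟩ := hs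
  refine ⟨⟨fun f => dec (f ∘ e) ∘ σ.symm, fun u f hf => ?_⟩, fun h E hE => ?_⟩
  · obtain ⟨f, hf', rfl⟩ := (PMF.mem_support_map_iff _ _ _).1 hf
    have : (f ∘ e.symm) ∘ e = f := by funext i; simp
    dsimp only
    rw [this, hdec _ _ hf']
    funext i
    simp
  · obtain ⟨μ, hμ⟩ := hs h E hE
    refine ⟨μ, fun u => ?_⟩
    rw [← hμ (u ∘ σ), PMF.map_comp]
    congr 1
    funext f v
    have : (f ∘ e.symm) ∘ e = f := by funext i; simp
    simp only [Function.comp_apply, CoopCode.contents_reindex, this]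

/-! ### The numbers of monomials -/

theorem card_codeMonomial {d t k : ℕ} (hkd : k ≤ d) :
    Fintype.card (CodeMonomial d t k) = k * (2 * d - k + t) := by
  have hge : ∀ N, k ≤ N → (Finset.univ.filter fun i : Fin N => ¬ i.val < k).card = N - k := by
    intro N hN
    have h1 := Finset.card_filter_add_card_filter_not (s := (Finset.univ : Finset (Fin N)))
      (fun i => i.val < k)
    rw [Fin.card_filter_val_lt, Finset.card_fin, min_eq_right hN] at h1
    omega
  have h := Finset.card_filter_add_card_filter_not
    (s := (Finset.univ : Finset (Fin d × Fin (d + t)))) (fun p => p.1.val < k ∨ p.2.val < k)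
  have hprod : (Finset.univ.filter fun p : Fin d × Fin (d + t) =>
      ¬ (p.1.val < k ∨ p.2.val < k)) = (Finset.univ.filter fun i : Fin d => ¬ i.val < k) ×ˢ
        (Finset.univ.filter fun j : Fin (d + t) => ¬ j.val < k) := by
    ext p
    simp
  rw [hprod, Finset.card_product, hge d hkd, hge (d + t) (by omega), Finset.card_univ,
    Fintype.card_prod, Fintype.card_fin, Fintype.card_fin] at h
  rw [Fintype.card_subtype]
  obtain ⟨c, rfl⟩ := Nat.exists_eq_add_of_le hkd
  rw [show k + c - k = c by omega, show k + c + t - k = c + t by omega] at h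
  rw [show 2 * (k + c) - k + t = k + 2 * c + t by omega]
  linarith

theorem card_dataMonomial {d t k ℓ : ℕ} (hℓ : ℓ ≤ k) (hkd : k ≤ d) :
    Fintype.card (DataMonomial d t k ℓ) = k * (2 * d - k + t) - ℓ * (2 * d - ℓ + t) := by
  rw [← card_codeMonomial hkd, ← card_codeMonomial (hℓ.trans hkd), Fintype.card_subtype,
    Fintype.card_subtype, Fintype.card_subtype, ← Finset.card_sdiff_of_subset]
  · congr 1
    ext p
    simp
  · intro p
    simp only [Finset.mem_filter, Finset.mem_univ, true_and]
    omega

/-! ### The secrecy capacity -/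

theorem mainTheorem3 {F : Type*} [Field F] [Fintype F] (n k d t ℓ : ℕ)
    (hk : 1 ≤ k) (hkd : k ≤ d) (ht : 1 ≤ t) (hn : d + t ≤ n) (hℓ : ℓ ≤ k) :
    -- the upper bound, over every finite field
    (∀ Ms ∈ mbcrSecureSizes F n k d t ℓ,
      Ms ≤ k * (2 * d - k + t) - ℓ * (2 * d - ℓ + t)) ∧
    -- the secrecy capacity, which is also attained under exact repair
    (n < Fintype.card F →
      IsGreatest (mbcrSecureSizes F n k d t ℓ)
        (k * (2 * d - k + t) - ℓ * (2 * d - ℓ + t)) ∧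
      IsGreatest (mbcrExactSecureSizes F n k d t ℓ)
        (k * (2 * d - k + t) - ℓ * (2 * d - ℓ + t))) ∧
    -- the polynomial scheme attains it
    Fintype.card (CodeMonomial d t k) = k * (2 * d - k + t) ∧
    Fintype.card (CodeMonomial d t ℓ) = ℓ * (2 * d - ℓ + t) ∧
    Fintype.card (DataMonomial d t k ℓ) = k * (2 * d - k + t) - ℓ * (2 * d - ℓ + t) ∧
    (∀ x y : Fin n → F, Function.Injective x → Function.Injective y →
      (∃ C : MBCRCode F (CodeMonomial d t k) n d t,
        C.encode = polyEncode x y ∧ C.RecoversFile k ∧ C.IsExactRepair ∧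
        C.IsSecure ℓ (randomFill : (DataMonomial d t k ℓ → F) → PMF (CodeMonomial d t k → F))) ∧
      -- given the data, the randomness can be decoded from any `ℓ` nodes
      (∀ E : Finset (Fin n), E.card = ℓ →
        ∃ D : (DataMonomial d t k ℓ → F) → (E → Fin (2 * d + t - 1) → F) →
            (CodeMonomial d t ℓ → F),
          ∀ u r, D u (fun i => polyEncode x y (fillCoeffs u r : CodeMonomial d t k → F) i) = r)) ∧
    -- the polynomial that is left over once the data monomials are removed
    (∀ (u : DataMonomial d t k ℓ → F) (r : CodeMonomial d t ℓ → F),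
      codePoly (fillCoeffs u r : CodeMonomial d t k → F) -
        codePoly (fillCoeffs u 0 : CodeMonomial d t k → F) = codePoly r) := by
  have hd : 1 ≤ d := hk.trans hkd
  have hupper : ∀ Ms ∈ mbcrSecureSizes F n k d t ℓ,
      Ms ≤ k * (2 * d - k + t) - ℓ * (2 * d - ℓ + t) := by
    rintro Ms ⟨C, enc, hC, hs⟩
    simpa using MBCRCode.secureSize_le hkd ht hn hℓ hC hs
  have hsub : mbcrExactSecureSizes F n k d t ℓ ⊆ mbcrSecureSizes F n k d t ℓ := by
    rintro Ms ⟨C, enc, hC, -, hs⟩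
    exact ⟨C, enc, hC, hs⟩
  refine ⟨hupper, fun hq => ?_, card_codeMonomial hkd, card_codeMonomial (hℓ.trans hkd),
    card_dataMonomial hℓ hkd, fun x y hx hy => ⟨⟨polyCode x y, rfl,
      polyCode_recoversFile hx hy hd hn, polyCode_isExactRepair hx hy hd hn,
      (polyCode_isPerfectlySecret hx hy hd hn hℓ hkd).isSecure⟩,
      fun E hE => exists_decoder_of_randomness hx hy hd hn hℓ hE⟩,
    codePoly_fillCoeffs_sub hℓ⟩
  have hmem : k * (2 * d - k + t) - ℓ * (2 * d - ℓ + t) ∈ mbcrExactSecureSizes F n k d t ℓ := by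
    obtain ⟨x⟩ : Nonempty (Fin n ↪ F) :=
      Function.Embedding.nonempty_of_card_le (by simpa using hq.le)
    let e := Fintype.equivFinOfCardEq (card_codeMonomial (t := t) hkd)
    let σ := Fintype.equivFinOfCardEq (card_dataMonomial (t := t) hℓ hkd)
    exact ⟨(polyCode x x).reindex e, _,
      (polyCode_recoversFile x.injective x.injective hd hn).reindex e,
      (polyCode_isExactRepair x.injective x.injective hd hn).reindex e,
      ((polyCode_isPerfectlySecret x.injective x.injective hd hn hℓ hkd).reindex e σ).isSecure⟩
  exact ⟨⟨hsub hmem, hupper⟩, ⟨hmem, fun Ms hMs => hupper Ms (hsub hMs)⟩⟩
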